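/- An integer vector $\mathbf v\in\mathbb Z^3$ is divisible by a positive integer $n$ if $\mathbf v=n\mathbf u$ for some $\mathbf u\in\mathbb Z^3$, and it is primitive if no positive integer $n\ne 1$ divides it. A cubic sublattice of $\mathbb Z^3$ is a subgroup $\Gamma$ that has a $\mathbb Z$-basis of three pairwise orthogonal vectors of equal Euclidean length; their common length is the edge length of $\Gamma$. For a vector $\mathbf v\in\mathbb Z^3$ and a positive integer $d$ put $$\Gamma(\mathbf v,d)=\{\mathbf a\in\mathbb Z^3 \mid \mathbf a\times\mathbf v \text{ is divisible by } d \text{ and } (\mathbf a\times\mathbf v)\times\mathbf v \text{ is divisible by } d^2\}.$$ Theorem. Let $\Gamma\subseteq\mathbb Z^3$ be a cubic sublattice. Then there are positive integers $k$ and $d$ and a primitive vector $\mathbf v\in\mathbb Z^3$, with $\|\mathbf v\|^2$ divisible by $d^2$, such that $\Gamma=k\,\Gamma(\mathbf v,d)$. The integers $k$ and $d$ are unique: if $\Gamma=k'\,\Gamma(\mathbf v',d')$ with positive integers $k',d'$ and a primitive vector $\mathbf v'\in\mathbb Z^3$, then $k'=k$ and $d'=d$. Moreover, $k$ is the greatest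 common divisor of the vectors of $\Gamma$ (it divides all of them, and every positive integer that divides all of them divides $k$), and the edge length of $\Gamma$ is well defined and equal to $kd$. -/

import Mathlib

open scoped Matrix Pointwise

/-- The integer vector `v` is divisible by `n`: `v = n u` for some integer vector `u`. -/
def VecDvd (n : ℕ) (v : Fin 3 → ℤ) : Prop :=
  ∃ u : Fin 3 → ℤ, v = (n : ℤ) • u

/-- A vector is primitive if no positive integer other than `1` divides it. -/
def IsPrimitiveVec (v : Fin 3 → ℤ) : Prop :=
  ∀ n : ℕ, 0 < n → VecDvd n v → n = 1

/-- Euclidean length, through the standard embedding of `ℤ³` into Euclidean space `ℝ³`. -/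
noncomputable def vecLength (v : Fin 3 → ℤ) : ℝ :=
  ‖(WithLp.toLp 2 (fun i => (v i : ℝ)) : EuclideanSpace ℝ (Fin 3))‖

/-- `b` is a cubic basis of `Γ` with edge length `r`: a `ℤ`-basis whose elements are pairwise
orthogonal and all have length `r`. -/
def IsCubicBasis {Γ : Submodule ℤ (Fin 3 → ℤ)} (b : Module.Basis (Fin 3) ℤ Γ) (r : ℝ) : Prop :=
  (∀ i j, i ≠ j → (b i : Fin 3 → ℤ) ⬝ᵥ (b j : Fin 3 → ℤ) = 0) ∧
    ∀ i, vecLength (b i : Fin 3 → ℤ) = r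

/-- `r` is an edge length of `Γ`: some cubic basis of `Γ` has common length `r`. -/
def IsEdgeLength (Γ : Submodule ℤ (Fin 3 → ℤ)) (r : ℝ) : Prop :=
  ∃ b : Module.Basis (Fin 3) ℤ Γ, IsCubicBasis b r

/-- A cubic sublattice of `ℤ³`: a subgroup that has a cubic basis (of three elements, so that it
has full rank). -/
def IsCubicSublattice (Γ : Submodule ℤ (Fin 3 → ℤ)) : Prop :=
  ∃ r : ℝ, IsEdgeLength Γ r

/-- `k` is the greatest common divisor of the vectors of `Γ`: it divides them all, and every
common divisor divides `k`. -/
def IsVecGcd (Γ : Submodule ℤ (Fin 3 → ℤ)) (k : ℕ) : Prop :=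
  (∀ a ∈ Γ, VecDvd k a) ∧ ∀ n : ℕ, (∀ a ∈ Γ, VecDvd n a) → n ∣ k

theorem VecDvd.zero_vec (n : ℕ) : VecDvd n 0 := ⟨0, by simp⟩

theorem VecDvd.add_vec {n : ℕ} {v w : Fin 3 → ℤ} (hv : VecDvd n v) (hw : VecDvd n w) :
    VecDvd n (v + w) := by
  obtain ⟨a, rfl⟩ := hv
  obtain ⟨b, rfl⟩ := hw
  exact ⟨a + b, by rw [smul_add]⟩

theorem VecDvd.smul_vec {n : ℕ} {v : Fin 3 → ℤ} (c : ℤ) (hv : VecDvd n v) :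
    VecDvd n (c • v) := by
  obtain ⟨a, rfl⟩ := hv
  exact ⟨c • a, smul_comm _ _ _⟩

/-- The lattice `Γ(v, d)` of all integer vectors `a` such that `a × v` is divisible by `d` and
`(a × v) × v` is divisible by `d ^ 2`. -/
def GammaLattice (v : Fin 3 → ℤ) (d : ℕ) : Submodule ℤ (Fin 3 → ℤ) where
  carrier := {a | VecDvd d (a ⨯₃ v) ∧ VecDvd (d ^ 2) ((a ⨯₃ v) ⨯₃ v)}
  zero_mem' := by
    simp only [Set.mem_ofPred_eq, map_zero, LinearMap.zero_apply]
    exact ⟨VecDvd.zero_vec _, VecDvd.zero_vec _⟩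
  add_mem' := by
    rintro a b ⟨ha, ha'⟩ ⟨hb, hb'⟩
    simp only [Set.mem_ofPred_eq, map_add, LinearMap.add_apply]
    exact ⟨ha.add_vec hb, ha'.add_vec hb'⟩
  smul_mem' := by
    rintro c a ⟨ha, ha'⟩
    simp only [Set.mem_ofPred_eq, map_smul, LinearMap.smul_apply]
    exact ⟨ha.smul_vec c, ha'.smul_vec c⟩

/-!
A cubic sublattice is the image `M ℤ³` of an integer matrix `M` with `Mᵀ M = R • 1`, where `√R` is
the edge length.

*Existence.* The sum `v₀` of a Smith normal form basis of `Γ` lies in `Γ` and has exactly the common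
divisors of `Γ` as divisors (`exists_mem_forall_vecDvd`). Writing `v₀ = k v` with `v` primitive and
dividing `M` by `k` leads to the case of a cubic lattice `M ℤ³` that contains a primitive vector
`v`. Here `det M = R s` with `s² = R`, and `(M x) × (M y) = s M (x × y)`; so for `d = |s|`, each
cross product of lattice vectors is `d` times a lattice vector, which gives `M ℤ³ ⊆ Γ(v, d)`.
Conversely, as `v` is primitive, each `a ∈ Γ(v, d)` is `c v + d e` with `d ∣ e · v`, while each
lattice vector is congruent to a multiple of `v` modulo `d`; hence `a · b` is divisible by `d² = R`
for all lattice vectors `b`, that is, `a` is in the lattice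
(`mem_gammaLattice_iff_exists_mulVec`).

*Uniqueness and edge length.* `Γ(v, d)` contains the primitive vector `v`, so `k` is the gcd of
`k Γ(v, d)`. The exponent of `ℤ³ / Γ(v, d)` is `d²` for every primitive `v`
(`sq_smul_mem_gammaLattice`, `dvd_of_forall_smul_mem_gammaLattice`), whereas a primitive cubic
lattice with `Mᵀ M = R • 1` has exponent `R`. So `R = (k d)²` whenever `M ℤ³ = k Γ(v, d)`, whatever
matrix describes the lattice (`eq_sq_mul_sq_of_eq_smul_gammaLattice`).
-/

open Matrix

/-! ### Divisibility and primitive vectors -/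

theorem vecDvd_iff {n : ℕ} {v : Fin 3 → ℤ} : VecDvd n v ↔ ∀ i, (n : ℤ) ∣ v i := by
  refine ⟨?_, fun h => ?_⟩
  · rintro ⟨u, rfl⟩ i
    exact ⟨u i, rfl⟩
  · choose u hu using h
    exact ⟨u, funext hu⟩

theorem VecDvd.dvd_dotProduct {n : ℕ} {v : Fin 3 → ℤ} (h : VecDvd n v) (w : Fin 3 → ℤ) :
    (n : ℤ) ∣ w ⬝ᵥ v := by
  obtain ⟨u, rfl⟩ := h
  exact ⟨w ⬝ᵥ u, by rw [dotProduct_smul, smul_eq_mul]⟩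

/-- A nonzero integer vector is a positive multiple of a primitive vector `u`, whose primitivity is
witnessed by a Bézout relation `w ⬝ᵥ u = 1`. -/
theorem exists_eq_smul_and_dotProduct_eq_one {v : Fin 3 → ℤ} (hv : v ≠ 0) :
    ∃ (k : ℕ) (u w : Fin 3 → ℤ), 0 < k ∧ v = (k : ℤ) • u ∧ w ⬝ᵥ u = 1 := by
  set g := Int.gcd (Int.gcd (v 0) (v 1) : ℤ) (v 2) with hg
  have h2 : (g : ℤ) ∣ v 2 := Int.gcd_dvd_right ..
  have h01 : (g : ℤ) ∣ (Int.gcd (v 0) (v 1) : ℤ) := Int.gcd_dvd_left ..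
  have hdvd : VecDvd g v := by
    rw [vecDvd_iff, Fin.forall_fin_succ, Fin.forall_fin_two]
    exact ⟨h01.trans (Int.gcd_dvd_left ..), h01.trans (Int.gcd_dvd_right ..), h2⟩
  obtain ⟨u, hu⟩ := hdvd
  have hg0 : g ≠ 0 := by
    rintro h0
    rw [h0] at hu
    exact hv (by simpa using hu)
  obtain ⟨w, hw⟩ : ∃ w : Fin 3 → ℤ, w ⬝ᵥ v = g := by
    have e1 := Int.gcd_eq_gcd_ab (Int.gcd (v 0) (v 1) : ℤ) (v 2)
    have e2 := Int.gcd_eq_gcd_ab (v 0) (v 1)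
    set a := Int.gcdA (Int.gcd (v 0) (v 1) : ℤ) (v 2)
    set b := Int.gcdB (Int.gcd (v 0) (v 1) : ℤ) (v 2)
    refine ⟨![Int.gcdA (v 0) (v 1) * a, Int.gcdB (v 0) (v 1) * a, b], ?_⟩
    rw [hg, e1, e2, vec3_dotProduct]
    simp only [cons_val]
    ring
  refine ⟨g, u, w, Nat.pos_of_ne_zero hg0, hu, ?_⟩
  rw [hu, dotProduct_smul, smul_eq_mul] at hw
  have : (g : ℤ) ≠ 0 := by exact_mod_cast hg0
  exact mul_left_cancel₀ this (by rw [hw, mul_one])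

theorem isPrimitiveVec_iff {v : Fin 3 → ℤ} : IsPrimitiveVec v ↔ ∃ w, w ⬝ᵥ v = 1 := by
  constructor
  · intro h
    have hv : v ≠ 0 := by
      rintro rfl
      have := h 2 (by norm_num) (VecDvd.zero_vec 2)
      omega
    obtain ⟨k, u, w, hk, rfl, hw⟩ := exists_eq_smul_and_dotProduct_eq_one hv
    obtain rfl := h k hk ⟨u, rfl⟩
    exact ⟨w, by simpa using hw⟩
  · rintro ⟨w, hw⟩ n - hd
    have := hd.dvd_dotProduct w
    rw [hw] at this
    exact Nat.dvd_one.1 (by exact_mod_cast this)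

/-! ### The lattices `Γ(v, d)` -/

theorem cross_cross_eq (a b c : Fin 3 → ℤ) :
    (a ⨯₃ b) ⨯₃ c = (a ⬝ᵥ c) • b - (b ⬝ᵥ c) • a := by
  ext i
  fin_cases i <;> simp [cross_apply, vec3_dotProduct] <;> ring

/-- If `v` is primitive, with Bézout vector `w`, then `a` is determined modulo multiples of `v` by
`a × v`. In particular `a` is a multiple of `v` modulo every divisor of `a × v`. -/
theorem eq_smul_add_cross {v w : Fin 3 → ℤ} (hw : w ⬝ᵥ v = 1) (a : Fin 3 → ℤ) :
    a = (w ⬝ᵥ a) • v + w ⨯₃ (a ⨯₃ v) := by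
  have : w ⨯₃ (a ⨯₃ v) = (w ⬝ᵥ v) • a - (w ⬝ᵥ a) • v := by
    ext i
    fin_cases i <;> simp [cross_apply, vec3_dotProduct] <;> ring
  rw [this, hw, one_smul]
  abel

theorem mem_gammaLattice {v : Fin 3 → ℤ} {d : ℕ} {a : Fin 3 → ℤ} :
    a ∈ GammaLattice v d ↔ VecDvd d (a ⨯₃ v) ∧ VecDvd (d ^ 2) ((a ⨯₃ v) ⨯₃ v) :=
  Iff.rfl

theorem self_mem_gammaLattice (v : Fin 3 → ℤ) (d : ℕ) : v ∈ GammaLattice v d := by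
  rw [mem_gammaLattice, cross_self, map_zero, LinearMap.zero_apply]
  exact ⟨VecDvd.zero_vec _, VecDvd.zero_vec _⟩

theorem sq_smul_mem_gammaLattice (v : Fin 3 → ℤ) (d : ℕ) (a : Fin 3 → ℤ) :
    ((d : ℤ) ^ 2) • a ∈ GammaLattice v d := by
  rw [mem_gammaLattice]
  simp only [map_smul, LinearMap.smul_apply]
  refine ⟨⟨(d : ℤ) • (a ⨯₃ v), by rw [smul_smul, sq]⟩, ⟨(a ⨯₃ v) ⨯₃ v, by push_cast; rfl⟩⟩

/-- For primitive `v`, the exponent of `ℤ³ / Γ(v, d)` is a multiple of `d ^ 2`. The coefficients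
`v i * v j` (`i ≠ j`) and `v i * v i - v ⬝ᵥ v` of the linear map `a ↦ (a × v) × v` generate the
unit ideal, because a prime dividing all of them would divide `v`. -/
theorem dvd_of_forall_smul_mem_gammaLattice {v : Fin 3 → ℤ} (hv : IsPrimitiveVec v) {d : ℕ}
    {m : ℤ} (h : ∀ a, m • a ∈ GammaLattice v d) : (d : ℤ) ^ 2 ∣ m := by
  obtain ⟨w, hw⟩ := isPrimitiveVec_iff.1 hv
  have key (a z : Fin 3 → ℤ) :
      (d : ℤ) ^ 2 ∣ m * ((a ⬝ᵥ v) * (z ⬝ᵥ v) - (v ⬝ᵥ v) * (z ⬝ᵥ a)) := by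
    have := (mem_gammaLattice.1 (h a)).2.dvd_dotProduct z
    simp only [map_smul, LinearMap.smul_apply, cross_cross_eq, dotProduct_smul, dotProduct_sub,
      smul_eq_mul] at this
    exact_mod_cast this
  -- The ideal of multipliers `t` with `d ^ 2 ∣ m * t` contains all coefficients of
  -- `a ↦ (a × v) × v`, so its radical contains the coordinates of `v`.
  let I : Ideal ℤ := Submodule.comap (LinearMap.mulLeft ℤ m) (Ideal.span {(d : ℤ) ^ 2})
  have hI (t : ℤ) : t ∈ I ↔ (d : ℤ) ^ 2 ∣ m * t := by
    simp [I, Ideal.mem_span_singleton]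
  have hoff (i j : Fin 3) (hij : i ≠ j) : v i * v j ∈ I := by
    rw [hI]
    have := key (Pi.single i 1) (Pi.single j 1)
    simpa [hij, hij.symm] using this
  have hdiag (i : Fin 3) : v i * v i - v ⬝ᵥ v ∈ I := by
    rw [hI]
    have := key (Pi.single i 1) (Pi.single i 1)
    simpa using this
  have hrad (i j l : Fin 3) (hil : i ≠ l)
      (hs : v ⬝ᵥ v = v i * v i + v j * v j + v l * v l) : v i ∈ I.radical := by
    refine ⟨4, ?_⟩
    have e : v i ^ 4 = -(v i ^ 2) * (v j * v j - v ⬝ᵥ v) + (-(v i * v l)) * (v i * v l) := by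
      rw [hs]; ring
    rw [e]
    exact I.add_mem (I.mul_mem_left _ (hdiag j)) (I.mul_mem_left _ (hoff i l hil))
  have h0 := hrad 0 1 2 (by decide) (by rw [vec3_dotProduct])
  have h1 := hrad 1 0 2 (by decide) (by rw [vec3_dotProduct]; ring)
  have h2 := hrad 2 0 1 (by decide) (by rw [vec3_dotProduct]; ring)
  have hone : (1 : ℤ) ∈ I.radical := by
    rw [← hw, vec3_dotProduct]
    exact add_mem (add_mem (Ideal.mul_mem_left _ _ h0) (Ideal.mul_mem_left _ _ h1))
      (Ideal.mul_mem_left _ _ h2)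
  obtain ⟨n, hn⟩ := hone
  rw [one_pow, hI, mul_one] at hn
  exact hn

/-! ### Integer matrices with `Mᵀ M = R • 1` -/

section CubicMatrix

variable {M : Matrix (Fin 3) (Fin 3) ℤ} {R : ℤ}

theorem det_sq_eq (hM : Mᵀ * M = R • (1 : Matrix (Fin 3) (Fin 3) ℤ)) : M.det ^ 2 = R ^ 3 := by
  have := congrArg det hM
  rwa [det_mul, det_transpose, det_smul, det_one, mul_one, ← sq, Fintype.card_fin] at this

theorem exists_det_eq (hM : Mᵀ * M = R • (1 : Matrix (Fin 3) (Fin 3) ℤ)) (hR : R ≠ 0) :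
    ∃ s, M.det = R * s ∧ s ^ 2 = R := by
  have h := det_sq_eq hM
  obtain ⟨s, hs⟩ : R ∣ M.det := by
    rw [← Int.pow_dvd_pow_iff (n := 2) (by norm_num), h]
    exact pow_dvd_pow R (by norm_num)
  refine ⟨s, hs, ?_⟩
  rw [hs] at h
  exact mul_left_cancel₀ (pow_ne_zero 2 hR) (by linear_combination h)

theorem mul_transpose_eq (hM : Mᵀ * M = R • (1 : Matrix (Fin 3) (Fin 3) ℤ)) (hR : R ≠ 0) :
    M * Mᵀ = R • (1 : Matrix (Fin 3) (Fin 3) ℤ) := by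
  have hdet : M.det ≠ 0 := by
    intro h
    have := det_sq_eq hM
    rw [h] at this
    exact pow_ne_zero 3 hR (by simpa using this.symm)
  have h : M.det • (M * Mᵀ) = M.det • (R • (1 : Matrix (Fin 3) (Fin 3) ℤ)) := by
    calc
      M.det • (M * Mᵀ) = M * Mᵀ * (M * M.adjugate) := by
        rw [mul_adjugate, Matrix.mul_smul, Matrix.mul_one]
      _ = M * (Mᵀ * M) * M.adjugate := by simp only [Matrix.mul_assoc]
      _ = _ := by
        rw [hM, Matrix.mul_smul, Matrix.mul_one, Matrix.smul_mul, mul_adjugate, smul_comm]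
  exact smul_right_injective _ hdet h

theorem adjugate_eq_smul_transpose (hM : Mᵀ * M = R • (1 : Matrix (Fin 3) (Fin 3) ℤ))
    (hR : R ≠ 0) {s : ℤ} (hs : M.det = R * s) : M.adjugate = s • Mᵀ := by
  have h : R • M.adjugate = R • (s • Mᵀ) := by
    calc
      R • M.adjugate = Mᵀ * M * M.adjugate := by
        rw [hM, Matrix.smul_mul, Matrix.one_mul]
      _ = _ := by
        rw [Matrix.mul_assoc, mul_adjugate, hs, Matrix.mul_smul, Matrix.mul_one, smul_smul]
  exact smul_right_injective _ hR h

theorem mulVec_cross_mulVec (M : Matrix (Fin 3) (Fin 3) ℤ) (x y : Fin 3 → ℤ) :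
    (M *ᵥ x) ⨯₃ (M *ᵥ y) = M.adjugateᵀ *ᵥ (x ⨯₃ y) := by
  ext i
  fin_cases i <;>
    simp [cross_apply, adjugate_fin_three, mulVec, vec3_dotProduct] <;> ring

theorem mulVec_dotProduct_mulVec (hM : Mᵀ * M = R • (1 : Matrix (Fin 3) (Fin 3) ℤ))
    (x y : Fin 3 → ℤ) : (M *ᵥ x) ⬝ᵥ (M *ᵥ y) = R * (x ⬝ᵥ y) := by
  rw [dotProduct_mulVec, ← mulVec_transpose, mulVec_mulVec, hM, smul_mulVec, one_mulVec,
    smul_dotProduct, smul_eq_mul]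

/-- An integer vector whose products with the columns of `M` are divisible by `R` lies in the
lattice `M ℤ³`: up to the factor `R` this lattice is its own dual. -/
theorem exists_mulVec_eq (hM : Mᵀ * M = R • (1 : Matrix (Fin 3) (Fin 3) ℤ)) (hR : R ≠ 0)
    {a : Fin 3 → ℤ} (ha : ∀ y, R ∣ a ⬝ᵥ (M *ᵥ y)) : ∃ x, a = M *ᵥ x := by
  have (i : Fin 3) : R ∣ (Mᵀ *ᵥ a) i := by
    have := ha (Pi.single i 1)
    rwa [mulVec_single_one, dotProduct_comm] at this
  choose x hx using this
  have hx' : Mᵀ *ᵥ a = R • x := funext hx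
  refine ⟨x, smul_right_injective _ hR ?_⟩
  calc R • a = (M * Mᵀ) *ᵥ a := by rw [mul_transpose_eq hM hR, smul_mulVec, one_mulVec]
    _ = R • (M *ᵥ x) := by rw [← mulVec_mulVec, hx', mulVec_smul]

/-- A cubic lattice `M ℤ³` equals `Γ(v, d)` for each primitive vector `v` that it contains, where
`d = √R` is its edge length. -/
theorem mem_gammaLattice_iff_exists_mulVec
    (hM : Mᵀ * M = R • (1 : Matrix (Fin 3) (Fin 3) ℤ)) (hR : R ≠ 0) {d : ℕ}
    {s : ℤ} (hs : M.det = R * s) (hsR : s ^ 2 = R) (hd : s.natAbs = d) {x : Fin 3 → ℤ}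
    (hv : IsPrimitiveVec (M *ᵥ x)) (a : Fin 3 → ℤ) :
    a ∈ GammaLattice (M *ᵥ x) d ↔ ∃ y, a = M *ᵥ y := by
  have hcross (y z : Fin 3 → ℤ) : (M *ᵥ y) ⨯₃ (M *ᵥ z) = s • (M *ᵥ (y ⨯₃ z)) := by
    rw [mulVec_cross_mulVec, adjugate_eq_smul_transpose hM hR hs, transpose_smul,
      transpose_transpose, smul_mulVec]
  have hds : (d : ℤ) ∣ s := by rw [← hd]; exact Int.natAbs_dvd.2 dvd_rfl
  have hdR : (d : ℤ) ^ 2 = R := by rw [← hd, Int.natAbs_sq, hsR]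
  constructor
  · rintro ⟨⟨p, hp⟩, hq⟩
    obtain ⟨w, hw⟩ := isPrimitiveVec_iff.1 hv
    set v := M *ᵥ x with hvx
    set e := w ⨯₃ p with he
    have hd0 : (d : ℤ) ≠ 0 := by
      rintro h0
      rw [h0] at hdR
      exact hR (by simpa using hdR.symm)
    -- `a` is congruent to a multiple of `v` modulo `d`, because `d ∣ a × v`.
    have hae : a = (w ⬝ᵥ a) • v + (d : ℤ) • e := by
      have := eq_smul_add_cross hw a
      rwa [hp, map_smul] at this
    have hev : (d : ℤ) ∣ e ⬝ᵥ v := by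
      have h1 := hq.dvd_dotProduct w
      rw [cross_cross_eq, dotProduct_sub, dotProduct_smul, dotProduct_smul, hw] at h1
      have h2 : a ⬝ᵥ v = (w ⬝ᵥ a) * (v ⬝ᵥ v) + d * (e ⬝ᵥ v) := by
        conv_lhs => rw [hae]
        simp only [add_dotProduct, smul_dotProduct, smul_eq_mul]
      rw [h2] at h1
      obtain ⟨t, ht⟩ := h1
      refine ⟨t, mul_left_cancel₀ hd0 ?_⟩
      push_cast at ht
      simp only [smul_eq_mul] at ht
      linear_combination ht
    refine exists_mulVec_eq hM hR fun y => ?_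
    -- `b × v` is divisible by `d` for `b = M y`, so `b` is a multiple of `v` modulo `d`, and
    -- `d ∣ e ⬝ᵥ v` carries over to `b`.
    have heb : (d : ℤ) ∣ e ⬝ᵥ (M *ᵥ y) := by
      have := eq_smul_add_cross hw (M *ᵥ y)
      rw [hvx, hcross, ← hvx, map_smul] at this
      rw [this, dotProduct_add, dotProduct_smul, dotProduct_smul]
      exact dvd_add (hev.mul_left _) (hds.mul_right _)
    rw [hae, add_dotProduct, smul_dotProduct, smul_dotProduct, hvx, mulVec_dotProduct_mulVec hM]
    refine dvd_add ((dvd_mul_right _ _).mul_left _) ?_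
    rw [← hdR, sq]
    exact mul_dvd_mul_left _ heb
  · rintro ⟨y, rfl⟩
    rw [mem_gammaLattice, hcross, map_smul, LinearMap.smul_apply, hcross, smul_smul]
    obtain ⟨t, ht⟩ := hds
    refine ⟨⟨t • M *ᵥ (y ⨯₃ x), by rw [smul_smul, ← ht]⟩,
      ⟨M *ᵥ ((y ⨯₃ x) ⨯₃ x), ?_⟩⟩
    push_cast
    rw [hdR, ← hsR, sq]

/-- If `M ℤ³ = k Γ(v, d)` with `v` primitive, then `R = (k d)²`, by comparison of the exponents of
the two lattices. No divisibility of `v ⬝ᵥ v` by `d ^ 2` is required. -/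
theorem eq_sq_mul_sq_of_eq_smul_gammaLattice
    (hM : Mᵀ * M = R • (1 : Matrix (Fin 3) (Fin 3) ℤ)) (hR : 0 < R)
    {Γ : Submodule ℤ (Fin 3 → ℤ)} (hΓ : ∀ a, a ∈ Γ ↔ ∃ x, a = M *ᵥ x) {k d : ℕ}
    {v : Fin 3 → ℤ} (hk : 0 < k) (hv : IsPrimitiveVec v) (h : Γ = (k : ℤ) • GammaLattice v d) :
    R = ((k : ℤ) * d) ^ 2 := by
  have hk0 : (k : ℤ) ≠ 0 := by exact_mod_cast hk.ne'
  have hmem (a : Fin 3 → ℤ) : a ∈ GammaLattice v d ↔ ∃ x, (k : ℤ) • a = M *ᵥ x := by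
    rw [← hΓ, h, Submodule.mem_smul_pointwise_iff_exists]
    refine ⟨fun ha => ⟨a, ha, rfl⟩, ?_⟩
    rintro ⟨b, hb, hba⟩
    rwa [← smul_right_injective _ hk0 hba]
  obtain ⟨w, hw⟩ := isPrimitiveVec_iff.1 hv
  obtain ⟨z, hz⟩ := (hmem v).1 (self_mem_gammaLattice v d)
  obtain ⟨x, hx⟩ := (hmem _).1 (sq_smul_mem_gammaLattice v d w)
  -- `k v` and `k d² w` are lattice vectors with product `(k d)²`, and products of lattice vectors
  -- are divisible by `R`.
  have h1 : R ∣ ((k : ℤ) * d) ^ 2 := by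
    refine ⟨x ⬝ᵥ z, ?_⟩
    rw [← mulVec_dotProduct_mulVec hM, ← hx, ← hz]
    simp only [smul_dotProduct, dotProduct_smul, hw, smul_eq_mul]
    ring
  obtain ⟨R', hR'⟩ : (k : ℤ) ^ 2 ∣ R := by
    have hcol : VecDvd k (M *ᵥ Pi.single 0 1) := by
      have : M *ᵥ Pi.single 0 1 ∈ Γ := (hΓ _).2 ⟨_, rfl⟩
      rw [h, Submodule.mem_smul_pointwise_iff_exists] at this
      obtain ⟨b, -, hb⟩ := this
      exact ⟨b, hb.symm⟩
    have := mulVec_dotProduct_mulVec hM (Pi.single 0 1) (Pi.single 0 1)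
    obtain ⟨u, hu⟩ := hcol
    rw [hu] at this
    refine ⟨u ⬝ᵥ u, ?_⟩
    simp only [smul_dotProduct, dotProduct_smul, smul_eq_mul, single_dotProduct, Pi.single_eq_same,
      mul_one] at this
    linear_combination -this
  -- `M (Mᵀ a) = R a`, so that `R' a` is in `Γ(v, d)` for all `a`.
  have h2 : (d : ℤ) ^ 2 ∣ R' := by
    refine dvd_of_forall_smul_mem_gammaLattice hv fun a => ?_
    have hcol (i : Fin 3) : (k : ℤ) ∣ (Mᵀ *ᵥ a) i := by
      have : M *ᵥ Pi.single i 1 ∈ Γ := (hΓ _).2 ⟨_, rfl⟩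
      rw [h, Submodule.mem_smul_pointwise_iff_exists] at this
      obtain ⟨b, -, hb⟩ := this
      have hd : VecDvd k (M *ᵥ Pi.single i 1) := ⟨b, hb.symm⟩
      have := hd.dvd_dotProduct a
      rwa [mulVec_single_one, dotProduct_comm] at this
    choose y hy using hcol
    have hy' : Mᵀ *ᵥ a = (k : ℤ) • y := funext hy
    refine (hmem _).2 ⟨y, smul_right_injective _ hk0 ?_⟩
    calc (k : ℤ) • (k : ℤ) • R' • a = R • a := by rw [smul_smul, smul_smul, hR']; ring_nf
      _ = (M * Mᵀ) *ᵥ a := by rw [mul_transpose_eq hM hR.ne', smul_mulVec, one_mulVec]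
      _ = (k : ℤ) • (M *ᵥ y) := by rw [← mulVec_mulVec, hy', mulVec_smul]
  refine Int.dvd_antisymm hR.le (sq_nonneg _) h1 ?_
  rw [hR', mul_pow]
  exact mul_dvd_mul_left _ h2

end CubicMatrix

/-! ### Greatest common divisors of the vectors of a lattice -/

theorem isVecGcd_of_eq_smul_gammaLattice {Γ : Submodule ℤ (Fin 3 → ℤ)} {k d : ℕ}
    {v : Fin 3 → ℤ} (hv : IsPrimitiveVec v) (h : Γ = (k : ℤ) • GammaLattice v d) :
    IsVecGcd Γ k := by
  constructor
  · intro a ha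
    rw [h, Submodule.mem_smul_pointwise_iff_exists] at ha
    obtain ⟨b, -, rfl⟩ := ha
    exact ⟨b, rfl⟩
  · intro n hn
    obtain ⟨w, hw⟩ := isPrimitiveVec_iff.1 hv
    have hmem : (k : ℤ) • v ∈ Γ := by
      rw [h]
      exact Submodule.smul_mem_pointwise_smul _ _ _ (self_mem_gammaLattice v d)
    have := (hn _ hmem).dvd_dotProduct w
    rw [dotProduct_smul, hw, smul_eq_mul, mul_one] at this
    exact_mod_cast this

theorem IsVecGcd.unique {Γ : Submodule ℤ (Fin 3 → ℤ)} {k l : ℕ} (hk : IsVecGcd Γ k)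
    (hl : IsVecGcd Γ l) : k = l :=
  Nat.dvd_antisymm (hl.2 _ hk.1) (hk.2 _ hl.1)

/-- Every sublattice contains a vector whose divisors divide the whole sublattice: the sum of the
basis vectors `c i • bM (f i)` in Smith normal form has the `c i` as coordinates. -/
theorem exists_mem_forall_vecDvd (Γ : Submodule ℤ (Fin 3 → ℤ)) :
    ∃ v ∈ Γ, ∀ n, VecDvd n v → ∀ a ∈ Γ, VecDvd n a := by
  obtain ⟨m, bM, bN, f, c, hsnf⟩ := Γ.smithNormalForm (Pi.basisFun ℤ (Fin 3))
  refine ⟨∑ i, (bN i : Fin 3 → ℤ), Γ.sum_mem fun i _ => (bN i).2, ?_⟩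
  rintro n ⟨u, hu⟩ a ha
  have hc (i : Fin m) : (n : ℤ) ∣ c i := by
    refine ⟨bM.repr u (f i), ?_⟩
    have := congrArg (fun t => bM.repr t (f i)) hu
    simp only [map_sum, hsnf, map_smul, bM.repr_self, Finsupp.coe_finsetSum, Finset.sum_apply,
      Finsupp.smul_apply, Finsupp.single_apply, f.injective.eq_iff, smul_eq_mul, mul_ite, mul_one,
      mul_zero, Finset.sum_ite_eq', Finset.mem_univ, if_true] at this
    exact this
  have hb (i : Fin m) : VecDvd n (bN i : Fin 3 → ℤ) := by
    obtain ⟨t, ht⟩ := hc i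
    exact ⟨t • bM (f i), by rw [hsnf, ht, mul_smul]⟩
  have hsum := congrArg Subtype.val (bN.sum_repr ⟨a, ha⟩)
  simp only [AddSubmonoidClass.coe_finsetSum, Submodule.coe_smul] at hsum
  rw [← hsum]
  exact Finset.sum_induction _ (VecDvd n) (fun _ _ => VecDvd.add_vec) (VecDvd.zero_vec n)
    fun i _ => (hb i).smul_vec _

/-! ### Cubic sublattices -/

theorem vecLength_eq_sqrt (v : Fin 3 → ℤ) : vecLength v = √((v ⬝ᵥ v : ℤ) : ℝ) := by
  rw [vecLength, EuclideanSpace.norm_eq]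
  congr 1
  simp [dotProduct, sq]

/-- The matrix `M` has the vectors of a cubic basis as columns. -/
theorem IsEdgeLength.exists_matrix {Γ : Submodule ℤ (Fin 3 → ℤ)} {r : ℝ}
    (h : IsEdgeLength Γ r) :
    ∃ (M : Matrix (Fin 3) (Fin 3) ℤ) (R : ℤ), Mᵀ * M = R • (1 : Matrix (Fin 3) (Fin 3) ℤ) ∧
      0 < R ∧ r = √(R : ℝ) ∧ ∀ a, a ∈ Γ ↔ ∃ x, a = M *ᵥ x := by
  obtain ⟨b, hb, hr⟩ := h
  have hpos : 0 < (b 0 : Fin 3 → ℤ) ⬝ᵥ (b 0 : Fin 3 → ℤ) := by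
    refine lt_of_le_of_ne (Finset.sum_nonneg fun i _ => mul_self_nonneg _) fun h0 => ?_
    exact b.ne_zero 0 (Subtype.ext (dotProduct_self_eq_zero.1 h0.symm))
  have hdiag (i : Fin 3) : (b i : Fin 3 → ℤ) ⬝ᵥ (b i : Fin 3 → ℤ) =
      (b 0 : Fin 3 → ℤ) ⬝ᵥ (b 0 : Fin 3 → ℤ) := by
    have h1 := (hr i).trans (hr 0).symm
    rw [vecLength_eq_sqrt, vecLength_eq_sqrt, Real.sqrt_inj] at h1
    · exact_mod_cast h1
    · exact_mod_cast Finset.sum_nonneg fun i _ => mul_self_nonneg _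
    · exact_mod_cast hpos.le
  have hmul (x : Fin 3 → ℤ) :
      (Matrix.of fun i j => (b j : Fin 3 → ℤ) i) *ᵥ x = ∑ j, x j • (b j : Fin 3 → ℤ) := by
    ext i
    simp [mulVec, dotProduct, Finset.sum_apply, mul_comm]
  refine ⟨Matrix.of fun i j => (b j : Fin 3 → ℤ) i, _, ?_, hpos, ?_, fun a => ⟨fun ha => ?_, ?_⟩⟩
  · ext i j
    have : ((Matrix.of fun i j => (b j : Fin 3 → ℤ) i)ᵀ *
        (Matrix.of fun i j => (b j : Fin 3 → ℤ) i)) i j =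
        (b i : Fin 3 → ℤ) ⬝ᵥ (b j : Fin 3 → ℤ) := rfl
    rw [this, Matrix.smul_apply, smul_eq_mul]
    rcases eq_or_ne i j with rfl | hij
    · rw [hdiag, one_apply_eq, mul_one]
    · rw [hb i j hij, one_apply_ne hij, mul_zero]
  · rw [← hr 0, vecLength_eq_sqrt]
  · refine ⟨fun i => b.repr ⟨a, ha⟩ i, ?_⟩
    rw [hmul]
    have hsum := congrArg Subtype.val (b.sum_repr ⟨a, ha⟩)
    simpa only [AddSubmonoidClass.coe_finsetSum, Submodule.coe_smul] using hsum.symm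
  · rintro ⟨x, rfl⟩
    rw [hmul]
    exact Γ.sum_mem fun j _ => Γ.smul_mem _ (b j).2

theorem exists_eq_smul_gammaLattice {Γ : Submodule ℤ (Fin 3 → ℤ)}
    {M : Matrix (Fin 3) (Fin 3) ℤ} {R : ℤ}
    (hM : Mᵀ * M = R • (1 : Matrix (Fin 3) (Fin 3) ℤ)) (hR : R ≠ 0)
    (hΓ : ∀ a, a ∈ Γ ↔ ∃ x, a = M *ᵥ x) :
    ∃ (k d : ℕ) (v : Fin 3 → ℤ), 0 < k ∧ 0 < d ∧ IsPrimitiveVec v ∧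
      (d : ℤ) ^ 2 ∣ v ⬝ᵥ v ∧ Γ = (k : ℤ) • GammaLattice v d := by
  obtain ⟨v₀, hv₀, hdvd⟩ := exists_mem_forall_vecDvd Γ
  have hcol (i : Fin 3) : M *ᵥ Pi.single i 1 ∈ Γ := (hΓ _).2 ⟨_, rfl⟩
  have hne : v₀ ≠ 0 := by
    rintro rfl
    -- If `v₀ = 0`, then `0` divides all vectors of `Γ`, so `Γ = 0`.
    obtain ⟨u, hu⟩ := hdvd 0 (VecDvd.zero_vec 0) _ (hcol 0)
    have := mulVec_dotProduct_mulVec hM (Pi.single 0 1) (Pi.single 0 1)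
    rw [hu] at this
    exact hR (by simpa using this.symm)
  obtain ⟨k, v, w, hk, rfl, hw⟩ := exists_eq_smul_and_dotProduct_eq_one hne
  have hk0 : (k : ℤ) ≠ 0 := by exact_mod_cast hk.ne'
  -- All entries of `M` are divisible by `k`; let `N` be the quotient.
  have hall := hdvd k ⟨v, rfl⟩
  have hent (i j : Fin 3) : (k : ℤ) ∣ M i j := by
    have := vecDvd_iff.1 (hall _ (hcol j)) i
    rwa [mulVec_single_one] at this
  choose N hN using hent
  obtain rfl : M = (k : ℤ) • Matrix.of N := by
    ext i j
    exact hN i j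
  have hNR : (Matrix.of N)ᵀ * Matrix.of N =
      ((Matrix.of N)ᵀ * Matrix.of N) 0 0 • (1 : Matrix (Fin 3) (Fin 3) ℤ) := by
    have hentry (i j : Fin 3) : (k : ℤ) * (k * ((Matrix.of N)ᵀ * Matrix.of N) i j) =
        R * (1 : Matrix (Fin 3) (Fin 3) ℤ) i j := by
      have := congrFun (congrFun hM i) j
      rw [transpose_smul, Matrix.smul_mul, Matrix.mul_smul] at this
      simpa only [Matrix.smul_apply, smul_eq_mul] using this
    ext i j
    refine mul_left_cancel₀ hk0 (mul_left_cancel₀ hk0 ?_)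
    have h00 := hentry 0 0
    rw [one_apply_eq, mul_one] at h00
    rw [hentry, ← h00, Matrix.smul_apply, smul_eq_mul]
    ring
  set S := ((Matrix.of N)ᵀ * Matrix.of N) 0 0
  have hS : S ≠ 0 := by
    intro hS
    rw [hS] at hNR
    have := congrFun (congrFun hM 0) 0
    rw [transpose_smul, Matrix.smul_mul, Matrix.mul_smul, hNR] at this
    exact hR (by simpa using this.symm)
  obtain ⟨s, hs, hsS⟩ := exists_det_eq hNR hS
  obtain ⟨x, hx⟩ := (hΓ _).1 hv₀
  rw [smul_mulVec] at hx
  obtain rfl : v = Matrix.of N *ᵥ x := smul_right_injective _ hk0 hx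
  have hv : IsPrimitiveVec (Matrix.of N *ᵥ x) := isPrimitiveVec_iff.2 ⟨w, hw⟩
  refine ⟨k, s.natAbs, _, hk, ?_, hv, ?_, ?_⟩
  · rw [Int.natAbs_pos]
    rintro rfl
    exact hS (by simpa using hsS.symm)
  · rw [mulVec_dotProduct_mulVec hNR, Int.natAbs_sq, hsS]
    exact dvd_mul_right _ _
  · ext a
    rw [hΓ, Submodule.mem_smul_pointwise_iff_exists]
    constructor
    · rintro ⟨y, rfl⟩
      exact ⟨_, (mem_gammaLattice_iff_exists_mulVec hNR hS hs hsS rfl hv _).2 ⟨y, rfl⟩,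
        (smul_mulVec ..).symm⟩
    · rintro ⟨b, hb, rfl⟩
      obtain ⟨y, rfl⟩ := (mem_gammaLattice_iff_exists_mulVec hNR hS hs hsS rfl hv _).1 hb
      exact ⟨y, (smul_mulVec ..).symm⟩

theorem theorem2 (Γ : Submodule ℤ (Fin 3 → ℤ)) (hΓ : IsCubicSublattice Γ) :
    ∃ k d : ℕ, 0 < k ∧ 0 < d ∧
      (∃ v : Fin 3 → ℤ, IsPrimitiveVec v ∧ ((d : ℤ) ^ 2 ∣ v ⬝ᵥ v) ∧
        Γ = (k : ℤ) • GammaLattice v d) ∧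
      (∀ (k' d' : ℕ) (v' : Fin 3 → ℤ), 0 < k' → 0 < d' → IsPrimitiveVec v' →
        Γ = (k' : ℤ) • GammaLattice v' d' → k' = k ∧ d' = d) ∧
      IsVecGcd Γ k ∧
      (∀ r : ℝ, IsEdgeLength Γ r ↔ r = (k : ℝ) * (d : ℝ)) := by
  -- Every edge length is determined by every representation `Γ = k Γ(v, d)`.
  have hlen {k d : ℕ} {v : Fin 3 → ℤ} (hk : 0 < k) (hv : IsPrimitiveVec v)
      (h : Γ = (k : ℤ) • GammaLattice v d) {r : ℝ} (hr : IsEdgeLength Γ r) :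
      r = (k : ℝ) * d := by
    obtain ⟨M, R, hM, hR, rfl, hmem⟩ := hr.exists_matrix
    rw [eq_sq_mul_sq_of_eq_smul_gammaLattice hM hR hmem hk hv h]
    push_cast
    exact Real.sqrt_sq (by positivity)
  obtain ⟨r₀, hr₀⟩ := hΓ
  obtain ⟨M, R, hM, hR, -, hmem⟩ := hr₀.exists_matrix
  obtain ⟨k, d, v, hk, hd, hv, hdv, h⟩ := exists_eq_smul_gammaLattice hM hR.ne' hmem
  refine ⟨k, d, hk, hd, ⟨v, hv, hdv, h⟩, ?_, isVecGcd_of_eq_smul_gammaLattice hv h, fun r =>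
    ⟨hlen hk hv h, ?_⟩⟩
  · intro k' d' v' hk' _ hv' h'
    obtain rfl : k' = k := (isVecGcd_of_eq_smul_gammaLattice hv' h').unique
      (isVecGcd_of_eq_smul_gammaLattice hv h)
    refine ⟨rfl, ?_⟩
    have := (hlen hk' hv' h' hr₀).symm.trans (hlen hk hv h hr₀)
    exact_mod_cast mul_left_cancel₀ (by exact_mod_cast hk.ne' : (k' : ℝ) ≠ 0) this
  · rintro rfl
    rwa [← hlen hk hv h hr₀]
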